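/- Let $Q=(Q_0,Q_1,s,t)$ be a finite acyclic quiver with a unique source, with vertices labelled $Q_0=\{0,1,\dots,\rho\}$ so that $0$ is the unique source and $s(a)<t(a)$ for every arrow $a\in Q_1$. Let $\mathbf r=(r_0,\dots,r_\rho)\in\mathbb N^{\rho+1}$ with $r_0=1$. The group $G=\prod_{i=1}^{\rho}\mathrm{GL}_{r_i}(\mathbb C)$ acts by change of basis on $$\mathrm{Rep}(Q,\mathbf r)=\bigoplus_{a\in Q_1}\mathrm{Hom}(\mathbb C^{r_{s(a)}},\mathbb C^{r_{t(a)}}),\qquad (g\cdot x)_a=g_{t(a)}\,x_a\,g_{s(a)}^{-1}\quad(g_0=1).$$ Let $\theta(g)=\prod_{i=1}^{\rho}\det(g_i)$, and let $\mathrm{Rep}(Q,\mathbf r)^{ss}$ be the $\theta$-semistable locus, that is, the set of points $x$ for which there are $n\ge 1$ and a polynomial function $f$ on $\mathrm{Rep}(Q,\mathbf r)$ with $f(g\cdot y)=\theta(g)^n f(y)$ for all $g\in G$ and all $y$, and with $f(x)\neq 0$. Let $M_\theta(Q,\mathbf r)=\mathrm{Rep}(Q,\mathbf r)^{ss}/G$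 be the quiver flag variety (the GIT quotient), with its quotient topology. The torus $T_Q=\prod_{a\in Q_1}\mathbb C^*$ acts on $\mathrm{Rep}(Q,\mathbf r)$ by $(\tau\cdot x)_a=\tau_a x_a$; this action commutes with that of $G$, preserves the semistable locus, and so induces an action of $T_Q$ on $M_\theta(Q,\mathbf r)$. **Proposition.** The fixed points of the $T_Q$-action on $M_\theta(Q,\mathbf r)$ are isolated: for every fixed point $p$ there is an open set $U\subseteq M_\theta(Q,\mathbf r)$ whose only $T_Q$-fixed point is $p$. This holds both for the Zariski topology and for the classical (Euclidean) topology. -/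

import Mathlib

noncomputable section

namespace QuiverFlag

/-- A quiver on the vertices `0, …, ρ` with arrows `A`, such that every arrow goes from a smaller
to a larger vertex (so the quiver is acyclic) and `0` is the unique source, i.e. the unique vertex
that is not the target of an arrow. -/
structure FlagQuiver (ρ : ℕ) (A : Type*) where
  s : A → Fin (ρ + 1)
  t : A → Fin (ρ + 1)
  s_lt_t : ∀ a, s a < t a
  exists_arrow_into : ∀ i, i ≠ 0 → ∃ a, t a = i

variable {ρ : ℕ} {A : Type*} (Q : FlagQuiver ρ A) (r : Fin (ρ + 1) → ℕ)

/-- The representation space `⨁ₐ Hom(ℂ^{r_{s(a)}}, ℂ^{r_{t(a)}})`. -/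
def Rep : Type _ := ∀ a : A, Matrix (Fin (r (Q.t a))) (Fin (r (Q.s a))) ℂ

@[ext] theorem Rep.ext {Q : FlagQuiver ρ A} {r : Fin (ρ + 1) → ℕ} {x y : Rep Q r}
    (h : ∀ a, x a = y a) : x = y := funext h

/-- The group `G = ∏_{i=1}^ρ GL(r_i)`. -/
abbrev Gauge : Type := ∀ i : Fin ρ, GL (Fin (r i.succ)) ℂ

/-- The embedding of `∏_{i=1}^ρ GL(r_i)` into `∏_{i=0}^ρ GL(r_i)`, with component `1` at `0`. -/
def Gauge.full {r : Fin (ρ + 1) → ℕ} (g : Gauge r) (i : Fin (ρ + 1)) : GL (Fin (r i)) ℂ :=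
  Fin.cases (motive := fun i => GL (Fin (r i)) ℂ) 1 g i

theorem Gauge.full_one (i : Fin (ρ + 1)) : (1 : Gauge r).full i = 1 := by
  refine Fin.cases ?_ (fun j => ?_) i <;> rfl

theorem Gauge.full_mul {r : Fin (ρ + 1) → ℕ} (g h : Gauge r) (i : Fin (ρ + 1)) :
    (g * h).full i = g.full i * h.full i := by
  refine Fin.cases ?_ (fun j => ?_) i
  · exact (one_mul 1).symm
  · rfl

/-- The action of `G` on representations by change of basis. -/
instance : MulAction (Gauge r) (Rep Q r) where
  smul g x := fun a =>
    (g.full (Q.t a)).val * x a * ((g.full (Q.s a))⁻¹).val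
  one_smul x := by
    refine Rep.ext fun a => ?_
    change ((1 : Gauge r).full (Q.t a)).val * x a * (((1 : Gauge r).full (Q.s a))⁻¹).val = x a
    simp [Gauge.full_one]
  mul_smul g h x := by
    refine Rep.ext fun a => ?_
    change ((g * h).full (Q.t a)).val * x a * (((g * h).full (Q.s a))⁻¹).val =
      (g.full (Q.t a)).val * ((h.full (Q.t a)).val * x a * ((h.full (Q.s a))⁻¹).val) *
        ((g.full (Q.s a))⁻¹).val
    rw [Gauge.full_mul, Gauge.full_mul, mul_inv_rev, Units.val_mul, Units.val_mul]
    simp only [Matrix.mul_assoc]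

/-- The stability condition: the character `θ(g) = ∏_{i=1}^ρ det(g_i)`. -/
def theta (g : Gauge r) : ℂ := ∏ i, (g i).val.det

/-- The index set of the matrix entries, i.e. of the coordinates on the representation space. -/
abbrev Coord : Type _ := Σ a : A, Fin (r (Q.t a)) × Fin (r (Q.s a))

/-- The value at `x` of a polynomial function on the representation space. -/
def Rep.eval {Q : FlagQuiver ρ A} {r : Fin (ρ + 1) → ℕ} (x : Rep Q r)
    (p : MvPolynomial (Coord Q r) ℂ) : ℂ :=
  MvPolynomial.eval (fun c : Coord Q r => x c.1 c.2.1 c.2.2) p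

/-- `p` is a semi-invariant of weight `θ ^ n`. -/
def IsSemiInvariant (n : ℕ) (p : MvPolynomial (Coord Q r) ℂ) : Prop :=
  ∀ (g : Gauge r) (x : Rep Q r), (g • x).eval p = theta r g ^ n * x.eval p

/-- The `θ`-semistable locus: the points at which some semi-invariant polynomial
of weight `θ ^ n` with `n ≥ 1` does not vanish. -/
def semistable : Set (Rep Q r) :=
  {x | ∃ n : ℕ, 1 ≤ n ∧ ∃ p : MvPolynomial (Coord Q r) ℂ, IsSemiInvariant Q r n p ∧ x.eval p ≠ 0}

theorem theta_mul (g h : Gauge r) : theta r (g * h) = theta r g * theta r h := by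
  simp [theta, Finset.prod_mul_distrib]

theorem theta_ne_zero (g : Gauge r) : theta r g ≠ 0 :=
  Finset.prod_ne_zero_iff.mpr fun i _ => ((Matrix.isUnit_iff_isUnit_det _).mp (g i).isUnit).ne_zero

theorem smul_mem_semistable (g : Gauge r) {x : Rep Q r} (hx : x ∈ semistable Q r) :
    g • x ∈ semistable Q r := by
  obtain ⟨n, hn, p, hp, hpx⟩ := hx
  exact ⟨n, hn, p, hp, by rw [hp g x]; exact mul_ne_zero (pow_ne_zero _ (theta_ne_zero r g)) hpx⟩

instance : MulAction (Gauge r) (semistable Q r) where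
  smul g x := ⟨g • x.1, smul_mem_semistable Q r g x.2⟩
  one_smul x := Subtype.ext (one_smul _ x.1)
  mul_smul g h x := Subtype.ext (mul_smul g h x.1)

/-- The quiver flag variety `M_θ(Q, r) = Rep(Q, r)^{ss}(θ) / G`. -/
def M : Type _ := MulAction.orbitRel.Quotient (Gauge r) (semistable Q r)

/-- The quotient map from the semistable locus to `M_θ(Q, r)`. -/
def M.mk {Q : FlagQuiver ρ A} {r : Fin (ρ + 1) → ℕ} (x : semistable Q r) : M Q r :=
  Quotient.mk (MulAction.orbitRel (Gauge r) (semistable Q r)) x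

/-- The Zariski topology of the representation space, generated by the principal open sets. -/
abbrev Rep.zariski : TopologicalSpace (Rep Q r) :=
  TopologicalSpace.generateFrom
    {U | ∃ p : MvPolynomial (Coord Q r) ℂ, U = {x | x.eval p ≠ 0}}

/-- The classical (Euclidean) topology of the representation space. -/
abbrev Rep.classical : TopologicalSpace (Rep Q r) :=
  inferInstanceAs
    (TopologicalSpace (∀ a : A, Matrix (Fin (r (Q.t a))) (Fin (r (Q.s a))) ℂ))

/-- The Zariski topology of `M_θ(Q, r)`: the quotient topology of the Zariski topology
of the semistable locus. -/
abbrev M.zariski : TopologicalSpace (M Q r) :=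
  TopologicalSpace.coinduced M.mk (TopologicalSpace.induced Subtype.val (Rep.zariski Q r))

/-- The classical topology of `M_θ(Q, r)`: the quotient topology of the classical topology
of the semistable locus. -/
abbrev M.classical : TopologicalSpace (M Q r) :=
  TopologicalSpace.coinduced M.mk (TopologicalSpace.induced Subtype.val (Rep.classical Q r))

/-- The torus `T_Q = ∏_{a ∈ A} ℂ^*`. -/
abbrev Torus (A : Type*) : Type _ := A → ℂˣ

/-- The action of `T_Q` on representations, by scaling the arrows. -/
instance : MulAction (Torus A) (Rep Q r) where
  smul τ x := fun a => (τ a : ℂ) • x a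
  one_smul x := by
    refine Rep.ext fun a => ?_
    change (((1 : Torus A) a : ℂˣ) : ℂ) • x a = x a
    simp
  mul_smul τ σ x := by
    refine Rep.ext fun a => ?_
    change (((τ * σ) a : ℂˣ) : ℂ) • x a = (τ a : ℂ) • ((σ a : ℂ) • x a)
    rw [Pi.mul_apply, Units.val_mul, mul_smul]

theorem torus_smul_gauge_smul (τ : Torus A) (g : Gauge r) (x : Rep Q r) :
    τ • (g • x) = g • (τ • x) := by
  refine Rep.ext fun a => ?_
  change (τ a : ℂ) • ((g.full (Q.t a)).val * x a * ((g.full (Q.s a))⁻¹).val) =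
    (g.full (Q.t a)).val * ((τ a : ℂ) • x a) * ((g.full (Q.s a))⁻¹).val
  rw [Matrix.mul_smul, Matrix.smul_mul]

/-- The polynomial `p` with each coordinate of the arrow `a` scaled by `τ a`. -/
def twist (τ : Torus A) (p : MvPolynomial (Coord Q r) ℂ) : MvPolynomial (Coord Q r) ℂ :=
  MvPolynomial.bind₁ (fun c : Coord Q r => MvPolynomial.C (τ c.1 : ℂ) * MvPolynomial.X c) p

theorem eval_twist (τ : Torus A) (p : MvPolynomial (Coord Q r) ℂ) (x : Rep Q r) :
    x.eval (twist Q r τ p) = (τ • x).eval p := by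
  unfold Rep.eval twist
  rw [MvPolynomial.eval, MvPolynomial.eval₂Hom_bind₁]
  congr 2
  funext c
  simp only [map_mul, MvPolynomial.eval₂Hom_C, MvPolynomial.eval₂Hom_X', RingHom.id_apply]
  rfl

theorem torus_smul_mem_semistable (τ : Torus A) {x : Rep Q r} (hx : x ∈ semistable Q r) :
    τ • x ∈ semistable Q r := by
  obtain ⟨n, hn, p, hp, hpx⟩ := hx
  refine ⟨n, hn, twist Q r τ⁻¹ p, fun g y => ?_, ?_⟩
  · rw [eval_twist, eval_twist, torus_smul_gauge_smul, hp]
  · rwa [eval_twist, inv_smul_smul]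

instance : MulAction (Torus A) (semistable Q r) where
  smul τ x := ⟨τ • x.1, torus_smul_mem_semistable Q r τ x.2⟩
  one_smul x := Subtype.ext (one_smul _ x.1)
  mul_smul τ σ x := Subtype.ext (mul_smul τ σ x.1)

/-- The action of `T_Q` on `M_θ(Q, r)`: `τ • [x] = [τ • x]`. -/
instance : MulAction (Torus A) (M Q r) where
  smul τ := Quotient.map (fun x : semistable Q r => τ • x) (by
    rintro x y ⟨g, rfl⟩
    exact ⟨g, Subtype.ext (torus_smul_gauge_smul Q r τ g y.1).symm⟩)
  one_smul m := by
    refine Quotient.inductionOn m fun x => ?_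
    exact congrArg M.mk (one_smul (Torus A) x)
  mul_smul τ σ m := by
    refine Quotient.inductionOn m fun x => ?_
    exact congrArg M.mk (mul_smul τ σ x)

/-- `p` is an isolated point of the set `F` for the topology `𝒯`. -/
def IsIsolatedIn {X : Type*} (𝒯 : TopologicalSpace X) (F : Set X) (p : X) : Prop :=
  ∃ U : Set X, @IsOpen X 𝒯 U ∧ U ∩ F = {p}

end QuiverFlag

end

/-!
A point `x` of the semistable locus assigns to every path `p` of the quiver from the source `0` to a
vertex `i` a vector `vec x p` in `ℂ ^ r i`, the image of `1 ∈ ℂ ^ r 0 = ℂ` under the maps along `p`.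
Semistability forces these vectors to span `ℂ ^ r i` (`span_range_vec`): a linear form that kills
all maps into a vertex gives a one-parameter subgroup of `G` that destabilises `x`
(`eq_zero_of_vecMul_eq_zero`).

If the class of `x` is fixed by the torus, then for every `τ` there is `g ∈ G` with `τ • x = g • x`,
so that `vec x p` is zero or an eigenvector of the component of `g` at `i`, with eigenvalue the
product of the `τ a` over the arrows of `p`. A path in an acyclic quiver is determined by the
multiset of its arrows, so if `τ` consists of distinct primes then these eigenvalues are distinct for
distinct paths. The nonzero path vectors at `i` are hence linearly independent
(`linearIndependent_vec`), thus a basis (`exists_basis_paths`), and there are exactly `r i` paths to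
`i` with nonzero vector. Calling this set of paths `S i`, a representation that is fixed modulo `G`
is determined up to `G` by the sets `S i` (`exists_smul_eq`).

Given a fixed point with path sets `S i`, let `U` be the locus where, for every `i`, the vectors of
the paths in `S i` form a basis of `ℂ ^ r i`. It is the principal open set of a product of
determinants, is stable under `G`, and a fixed point in `U` must have the same path sets `S i`,
because it has no more than `r i` nonzero path vectors at `i`.
-/

noncomputable section

namespace QuiverFlag

open Matrix Topology

variable {ρ : ℕ} {A : Type*} {Q : FlagQuiver ρ A} {r : Fin (ρ + 1) → ℕ}

/-! ### Paths from the source and their vectors -/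

/-- The paths of the quiver from the source `0` to the vertex `i`, built by appending arrows at
their end. -/
inductive Path (Q : FlagQuiver ρ A) : Fin (ρ + 1) → Type _
  | nil : Path Q 0
  | cons (a : A) (p : Path Q (Q.s a)) : Path Q (Q.t a)

/-- The arrows of a path, the last arrow first. -/
def Path.arrows : ∀ {i : Fin (ρ + 1)}, Path Q i → List A
  | _, .nil => []
  | _, .cons a p => a :: p.arrows

theorem Path.t_le_of_mem_arrows {i : Fin (ρ + 1)} (p : Path Q i) :
    ∀ a ∈ p.arrows, Q.t a ≤ i := by
  induction p with
  | nil => simp [arrows]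
  | cons b p ih =>
    intro a ha
    rcases List.mem_cons.mp ha with rfl | ha
    · exact le_rfl
    · exact (ih a ha).trans (Q.s_lt_t b).le

theorem Path.pairwise_arrows {i : Fin (ρ + 1)} (p : Path Q i) :
    p.arrows.Pairwise fun a b => Q.t b < Q.t a := by
  induction p with
  | nil => exact List.Pairwise.nil
  | cons b p ih =>
    exact List.pairwise_cons.mpr
      ⟨fun a ha => (p.t_le_of_mem_arrows a ha).trans_lt (Q.s_lt_t b), ih⟩

theorem Path.sigma_eq_of_arrows_eq {i : Fin (ρ + 1)} (p : Path Q i) :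
    ∀ {j : Fin (ρ + 1)} (q : Path Q j), p.arrows = q.arrows →
      (⟨i, p⟩ : Σ i, Path Q i) = ⟨j, q⟩ := by
  induction p with
  | nil =>
    intro j q h
    cases q with
    | nil => rfl
    | cons a q => simp [arrows] at h
  | cons a p ih =>
    intro j q h
    cases q with
    | nil => simp [arrows] at h
    | cons b q =>
      obtain ⟨rfl, h⟩ := List.cons.inj h
      obtain rfl := eq_of_heq (Sigma.mk.inj (ih q h)).2
      rfl

/-- A path is determined by the multiset of its arrows, since their order is that of their
targets. -/
theorem Path.eq_of_arrows_perm {i : Fin (ρ + 1)} {p q : Path Q i} (h : p.arrows.Perm q.arrows) :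
    p = q := by
  have h' := h.eq_of_pairwise (fun a b _ _ hab hba => absurd hab (lt_asymm hba))
    p.pairwise_arrows q.pairwise_arrows
  exact eq_of_heq (Sigma.mk.inj (p.sigma_eq_of_arrows_eq q h')).2

/-- The character of the torus by which it scales the vector of a path. -/
def Path.weight {i : Fin (ρ + 1)} (p : Path Q i) (τ : Torus A) : ℂ :=
  (p.arrows.map fun a => (τ a : ℂ)).prod

/-- By unique factorisation, a torus element with distinct primes as its components separates the
weights of distinct paths. -/
theorem exists_torus_weight_injective [Finite A] (Q : FlagQuiver ρ A) :
    ∃ τ : Torus A, ∀ i, Function.Injective fun p : Path Q i => p.weight τ := by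
  obtain ⟨e, he⟩ := exists_injective_nat A
  let f : A → ℕ := fun a => Nat.nth Nat.Prime (e a)
  have hf : Function.Injective f := (Nat.nth_injective Nat.infinite_setOfPred_prime).comp he
  have hp : ∀ a, (f a).Prime := fun a => Nat.prime_nth_prime _
  refine ⟨fun a => Units.mk0 (f a : ℂ) (Nat.cast_ne_zero.mpr (hp a).ne_zero), fun i p q h => ?_⟩
  have hw : ∀ p : Path Q i, p.weight (fun a => Units.mk0 (f a : ℂ)
      (Nat.cast_ne_zero.mpr (hp a).ne_zero)) = ((p.arrows.map f).prod : ℕ) := fun p => by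
    simp [Path.weight, Nat.cast_list_prod, Function.comp_def]
  simp only [hw, Nat.cast_inj] at h
  refine Path.eq_of_arrows_perm ((List.map_perm_map_iff hf).mp ?_)
  have hl : ∀ l : List A, ∀ n ∈ l.map f, n.Prime := fun l n hn => by
    obtain ⟨a, -, rfl⟩ := List.mem_map.mp hn
    exact hp a
  exact (Nat.primeFactorsList_unique h (hl _)).trans (Nat.primeFactorsList_unique rfl (hl _)).symm

/-- The image of `1` under the maps of `x` along a path. At the source it is the vector with all
entries `1`, which is the element `1` of `ℂ` when `r 0 = 1`. -/
def vec (x : Rep Q r) : ∀ {i : Fin (ρ + 1)}, Path Q i → Fin (r i) → ℂ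
  | _, .nil => fun _ => 1
  | _, .cons a p => x a *ᵥ vec x p

theorem vec_gauge_smul (g : Gauge r) (x : Rep Q r) {i : Fin (ρ + 1)} (p : Path Q i) :
    vec (g • x) p = (g.full i).val *ᵥ vec x p := by
  induction p with
  | nil => exact (one_mulVec _).symm
  | cons a p ih =>
    change ((g.full (Q.t a)).val * x a * ((g.full (Q.s a))⁻¹).val) *ᵥ vec (g • x) p =
      (g.full (Q.t a)).val *ᵥ (x a *ᵥ vec x p)
    rw [ih, mulVec_mulVec, mulVec_mulVec, Matrix.mul_assoc, Units.inv_mul, Matrix.mul_one]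

theorem vec_torus_smul (τ : Torus A) (x : Rep Q r) {i : Fin (ρ + 1)} (p : Path Q i) :
    vec (τ • x) p = p.weight τ • vec x p := by
  induction p with
  | nil => simp [vec, Path.weight, Path.arrows]
  | cons a p ih =>
    change ((τ a : ℂ) • x a) *ᵥ vec (τ • x) p = _
    rw [ih, mulVec_smul, smul_mulVec, smul_smul, mul_comm]
    rfl

/-- The coordinates of the vector of a path, as polynomials on the representation space. -/
def vecPoly (r : Fin (ρ + 1) → ℕ) :
    ∀ {i : Fin (ρ + 1)}, Path Q i → Fin (r i) → MvPolynomial (Coord Q r) ℂ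
  | _, .nil => fun _ => 1
  | _, .cons a p => fun j => ∑ k, MvPolynomial.X ⟨a, j, k⟩ * vecPoly r p k

theorem eval_vecPoly (x : Rep Q r) {i : Fin (ρ + 1)} (p : Path Q i) (j : Fin (r i)) :
    x.eval (vecPoly r p j) = vec x p j := by
  induction p with
  | nil => simp [vecPoly, vec, Rep.eval]
  | cons a p ih =>
    simp only [Rep.eval] at ih
    simp [vecPoly, vec, Rep.eval, mulVec, dotProduct, ih]

/-! ### Semistability -/

/-- A family of linear forms that vanishes at the source and kills all the maps of a semistable
representation is zero. -/
theorem eq_zero_of_vecMul_eq_zero {x : Rep Q r} (hx : x ∈ semistable Q r)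
    (φ : ∀ i, Fin (r i) → ℂ) (h0 : φ 0 = 0) (h : ∀ a, φ (Q.t a) ᵥ* x a = 0) : φ = 0 := by
  classical
  by_contra hφ
  obtain ⟨n, hn, p, hp, hpx⟩ := hx
  have hv : ∀ i, ∃ v : Fin (r i) → ℂ, φ i ⬝ᵥ v = if φ i = 0 then 0 else 1 := fun i => by
    by_cases hi : φ i = 0
    · exact ⟨0, by simp [hi]⟩
    · obtain ⟨k, hk⟩ := Function.ne_iff.mp hi
      exact ⟨Pi.single k (φ i k)⁻¹, by simpa [hi] using mul_inv_cancel₀ hk⟩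
  choose v hv using hv
  -- `N i` is a projection onto a complement of the kernel of `φ i`.
  let N : ∀ i, Matrix (Fin (r i)) (Fin (r i)) ℂ := fun i => vecMulVec (v i) (φ i)
  have hN : ∀ i, N i * N i = N i := fun i => by
    by_cases hi : φ i = 0
    · simp [N, hi]
    · simp [N, vecMulVec_mul_vecMulVec, hv, hi]
  have hinv : ∀ i (b c : ℂ), b * c = 1 → (1 + (b - 1) • N i) * (1 + (c - 1) • N i) = 1 := by
    intro i b c hbc
    simp only [Matrix.add_mul, Matrix.mul_add, Matrix.one_mul, Matrix.mul_one, Matrix.smul_mul,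
      Matrix.mul_smul, hN]
    match_scalars
    · rfl
    · linear_combination hbc
  have hdet : ∀ i (b : ℂ), (1 + (b - 1) • N i).det = if φ i = 0 then 1 else b := fun i b => by
    rw [show (b - 1) • N i = vecMulVec ((b - 1) • v i) (φ i) from (smul_vecMulVec _ _ _).symm,
      vecMulVec_eq Unit, det_one_add_replicateCol_mul_replicateRow, dotProduct_smul, hv]
    split_ifs <;> simp
  -- The one-parameter subgroup with weights `0` on the kernel and `-1` on the complement.
  let g : ℂˣ → Gauge r := fun z i =>
    ⟨1 + ((z⁻¹ : ℂˣ) - 1 : ℂ) • N i.succ, 1 + (z - 1 : ℂ) • N i.succ,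
      hinv _ _ _ (by simp), hinv _ _ _ (by simp)⟩
  let y : ℂ → Rep Q r := fun z a => x a * (1 + (z - 1) • N (Q.s a))
  have hg : ∀ (z : ℂˣ) i, ((g z).full i).val = 1 + ((z⁻¹ : ℂˣ) - 1 : ℂ) • N i ∧
      (((g z).full i)⁻¹).val = 1 + (z - 1 : ℂ) • N i := fun z i => by
    refine Fin.cases ?_ (fun j => ⟨rfl, rfl⟩) i
    have : N 0 = 0 := by simp [N, h0]
    rw [this, smul_zero, smul_zero, add_zero]
    exact ⟨rfl, rfl⟩
  have hNx : ∀ a, N (Q.t a) * x a = 0 := fun a => by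
    rw [vecMulVec_mul, h]
    ext
    simp [vecMulVec_apply]
  have hy : ∀ z : ℂˣ, g z • x = y z := fun z => by
    refine Rep.ext fun a => ?_
    change ((g z).full (Q.t a)).val * x a * (((g z).full (Q.s a))⁻¹).val = _
    -- `x` maps into the kernels of `φ`, where `g z` acts trivially.
    rw [(hg z _).1, (hg z _).2, Matrix.add_mul, Matrix.one_mul, Matrix.smul_mul,
      hNx, smul_zero, add_zero]
  obtain ⟨i, hi⟩ := Function.ne_iff.mp hφ
  obtain ⟨i, rfl⟩ := Fin.exists_succ_eq.mpr (show i ≠ 0 by rintro rfl; exact hi h0)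
  let c := (Finset.univ.filter fun i : Fin ρ => φ i.succ ≠ 0).card
  have hc : c ≠ 0 := Finset.card_ne_zero_of_mem (Finset.mem_filter.mpr ⟨Finset.mem_univ i, hi⟩)
  have hθ : ∀ z : ℂˣ, theta r (g z) = (z : ℂ)⁻¹ ^ c := fun z => by
    simp only [theta, g, hdet]
    simp [Finset.prod_ite, c]
  -- The two sides agree for `z ≠ 0`, hence also at `z = 0`, where the left one vanishes.
  have key : (fun z : ℂ => z ^ (c * n) * (y z).eval p) = fun _ => x.eval p := by
    refine Continuous.ext_on (dense_compl_singleton (0 : ℂ)) ?_ continuous_const ?_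
    · refine (continuous_pow _).mul ((MvPolynomial.continuous_eval p).comp ?_)
      refine continuous_pi fun d => ?_
      exact (continuous_const.matrix_mul (continuous_const.add
        ((continuous_id.sub continuous_const).smul continuous_const))).matrix_elem _ _
    · intro z (hz : z ≠ 0)
      have h1 := hp (g (Units.mk0 z hz)) x
      rw [hy, hθ] at h1
      rw [Units.val_mk0] at h1
      change z ^ (c * n) * (y z).eval p = x.eval p
      rw [h1, ← mul_assoc, ← pow_mul, ← mul_pow, mul_inv_cancel₀ hz, one_pow, one_mul]
  have h2 := congrFun key 0
  simp only [zero_pow (mul_ne_zero hc (Nat.one_le_iff_ne_zero.mp hn)), zero_mul] at h2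
  exact hpx h2.symm

theorem span_range_vec (hr : r 0 = 1) {x : Rep Q r} (hx : x ∈ semistable Q r)
    (i : Fin (ρ + 1)) : Submodule.span ℂ (Set.range fun p : Path Q i => vec x p) = ⊤ := by
  classical
  induction i using WellFoundedLT.induction with
  | ind i ih =>
    by_cases hi : i = 0
    · subst hi
      refine Submodule.eq_top_iff'.mpr fun w => ?_
      have : Subsingleton (Fin (r 0)) := by rw [hr]; infer_instance
      have hw : w = w ⟨0, by omega⟩ • vec x Path.nil := by
        funext k
        rw [Subsingleton.elim k ⟨0, by omega⟩]
        simp [vec]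
      rw [hw]
      exact Submodule.smul_mem _ _ (Submodule.subset_span ⟨_, rfl⟩)
    · by_contra hne
      obtain ⟨f, hf0, hf⟩ := Submodule.exists_le_ker_of_lt_top _ (lt_top_iff_ne_top.mpr hne)
      have hdot : ∀ w, (fun k => f (Pi.single k 1)) ⬝ᵥ w = f w := fun w => by
        rw [LinearMap.pi_apply_eq_sum_univ f w]
        refine Finset.sum_congr rfl fun k _ => ?_
        rw [smul_eq_mul, mul_comm]
        congr 1
        refine congrArg f (funext fun l => ?_)
        simp [Pi.single_apply, eq_comm]
      have h := eq_zero_of_vecMul_eq_zero hx (Pi.single i fun k => f (Pi.single k 1))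
        (Pi.single_eq_of_ne (Ne.symm hi) _) fun a => by
          by_cases ha : Q.t a = i
          · subst ha
            rw [Pi.single_eq_same]
            have h0 : f ∘ₗ (x a).mulVecLin = 0 := by
              refine LinearMap.ext_on (ih _ (Q.s_lt_t a)) ?_
              rintro _ ⟨p, rfl⟩
              exact hf (Submodule.subset_span ⟨Path.cons a p, rfl⟩)
            funext k
            have := LinearMap.congr_fun h0 (Pi.single k 1)
            rw [LinearMap.comp_apply, mulVecLin_apply, mulVec_single_one, ← hdot] at this
            exact this
          · rw [Pi.single_eq_of_ne ha, zero_vecMul]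
      have h' := congrFun h i
      rw [Pi.single_eq_same] at h'
      exact hf0 (LinearMap.ext fun w => by rw [← hdot, h']; simp)

/-! ### Representations fixed by the torus up to the gauge group -/

/-- The torus fixes the class of `x` modulo the gauge group. -/
def IsFixed (x : Rep Q r) : Prop :=
  ∀ τ : Torus A, ∃ g : Gauge r, τ • x = g • x

/-- The nonzero path vectors at a vertex of a fixed representation are eigenvectors, of a single
matrix, for distinct eigenvalues. -/
theorem linearIndependent_vec [Finite A] {x : Rep Q r} (hx : IsFixed x) (i : Fin (ρ + 1)) :
    LinearIndependent ℂ fun p : {p : Path Q i // vec x p ≠ 0} => vec x p.1 := by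
  obtain ⟨τ, hτ⟩ := exists_torus_weight_injective Q
  obtain ⟨g, hg⟩ := hx τ
  refine Module.End.eigenvectors_linearIndependent' (g.full i).val.mulVecLin
    (fun p => p.1.weight τ) ((hτ i).comp Subtype.val_injective) _ fun p => ?_
  refine ⟨Module.End.mem_eigenspace_iff.mpr ?_, p.2⟩
  rw [mulVecLin_apply, ← vec_gauge_smul, ← hg, vec_torus_smul]

/-- There are exactly `r i` paths to `i` with nonzero vector. -/
theorem nonempty_equiv_paths [Finite A] (hr : r 0 = 1) {x : Rep Q r}
    (hx : x ∈ semistable Q r) (hfix : IsFixed x) (i : Fin (ρ + 1)) :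
    Nonempty (Fin (r i) ≃ {p : Path Q i // vec x p ≠ 0}) := by
  have hspan : ⊤ ≤ Submodule.span ℂ
      (Set.range fun p : {p : Path Q i // vec x p ≠ 0} => vec x p.1) := by
    rw [← span_range_vec hr hx i, Submodule.span_le]
    rintro _ ⟨p, rfl⟩
    by_cases hp : vec x p = 0
    · simp [hp]
    · exact Submodule.subset_span ⟨⟨p, hp⟩, rfl⟩
  exact ⟨(Pi.basisFun ℂ (Fin (r i))).indexEquiv (.mk (linearIndependent_vec hfix i) hspan)⟩

/-- The matrix whose columns are the vectors of the paths `S`. -/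
def pathMatrix (x : Rep Q r) {i : Fin (ρ + 1)} (S : Fin (r i) → Path Q i) :
    Matrix (Fin (r i)) (Fin (r i)) ℂ :=
  Matrix.of fun j k => vec x (S k) j

theorem pathMatrix_mulVec_single (x : Rep Q r) {i : Fin (ρ + 1)} (S : Fin (r i) → Path Q i)
    (k : Fin (r i)) : pathMatrix x S *ᵥ Pi.single k 1 = vec x (S k) := by
  rw [mulVec_single_one]
  rfl

theorem exists_basis_paths [Finite A] (hr : r 0 = 1) {x : Rep Q r}
    (hx : x ∈ semistable Q r) (hfix : IsFixed x) :
    ∃ S : ∀ i, Fin (r i) → Path Q i, ∀ i, IsUnit (pathMatrix x (S i)) := by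
  have e := fun i => (nonempty_equiv_paths hr hx hfix i).some
  refine ⟨fun i k => (e i k).1, fun i => linearIndependent_cols_iff_isUnit.mp ?_⟩
  exact (linearIndependent_vec hfix i).comp _ (e i).injective

theorem vec_eq_zero_of_notMem_range [Finite A] (hr : r 0 = 1) {x : Rep Q r}
    (hx : x ∈ semistable Q r) (hfix : IsFixed x) {i : Fin (ρ + 1)} {S : Fin (r i) → Path Q i}
    (hS : IsUnit (pathMatrix x S)) {q : Path Q i} (hq : q ∉ Set.range S) : vec x q = 0 := by
  have hli : LinearIndependent ℂ fun k => vec x (S k) := linearIndependent_cols_iff_isUnit.mpr hS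
  obtain ⟨e⟩ := nonempty_equiv_paths hr hx hfix i
  by_contra hne
  let f : Fin (r i) → {p : Path Q i // vec x p ≠ 0} := fun k => ⟨S k, hli.ne_zero k⟩
  have hf : Function.Injective f := fun k l hkl =>
    hli.injective (congrArg (fun p => vec x p.1) hkl)
  obtain ⟨k, hk⟩ := (Finite.injective_iff_surjective_of_equiv e).mp hf ⟨q, hne⟩
  exact hq ⟨k, congrArg Subtype.val hk⟩

/-- The change of basis that carries the basis of path vectors of `x` to that of `y` carries `x` to
`y`. -/
theorem exists_smul_eq [Finite A] (hr : r 0 = 1) {x y : Rep Q r}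
    (hx : x ∈ semistable Q r) (hy : y ∈ semistable Q r) (hxf : IsFixed x) (hyf : IsFixed y)
    {S : ∀ i, Fin (r i) → Path Q i} (hxS : ∀ i, IsUnit (pathMatrix x (S i)))
    (hyS : ∀ i, IsUnit (pathMatrix y (S i))) : ∃ g : Gauge r, g • x = y := by
  let g : Gauge r := fun i => (hyS i.succ).unit * (hxS i.succ).unit⁻¹
  have hg : ∀ i (p : Path Q i), (g.full i).val *ᵥ vec x p = vec y p := by
    intro i
    refine Fin.cases (fun p => ?_) (fun i p => ?_) i
    · have h0 : p = Path.nil := Path.eq_of_arrows_perm <| by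
        have : p.arrows = [] := List.eq_nil_iff_forall_not_mem.mpr fun a ha =>
          absurd (p.t_le_of_mem_arrows a ha)
            (not_le.mpr ((Fin.zero_le _).trans_lt (Q.s_lt_t a)))
        rw [this]
        exact List.Perm.nil
      rw [h0]
      exact one_mulVec _
    · by_cases hp : p ∈ Set.range (S i.succ)
      · obtain ⟨k, rfl⟩ := hp
        rw [← pathMatrix_mulVec_single, ← pathMatrix_mulVec_single, mulVec_mulVec]
        congr 1
        exact congrArg Units.val
          (inv_mul_cancel_right (hyS i.succ).unit (hxS i.succ).unit)
      · rw [vec_eq_zero_of_notMem_range hr hx hxf (hxS _) hp,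
          vec_eq_zero_of_notMem_range hr hy hyf (hyS _) hp, mulVec_zero]
  refine ⟨g, Rep.ext fun a => ?_⟩
  have h1 : (g.full (Q.t a)).val * x a = y a * (g.full (Q.s a)).val := by
    refine Matrix.toLin'.injective (LinearMap.ext_on (span_range_vec hr hx (Q.s a)) ?_)
    rintro _ ⟨p, rfl⟩
    simp only [toLin'_apply, ← mulVec_mulVec, hg]
    exact hg _ (Path.cons a p)
  change (g.full (Q.t a)).val * x a * ((g.full (Q.s a))⁻¹).val = y a
  rw [h1, Matrix.mul_assoc, Units.mul_inv, Matrix.mul_one]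

/-! ### The open set isolating a fixed point -/

/-- The polynomial whose principal open set is the locus where the vectors of the paths `S i` form
a basis at every vertex `i`. -/
def basisPoly (S : ∀ i, Fin (r i) → Path Q i) : MvPolynomial (Coord Q r) ℂ :=
  ∏ i, (Matrix.of fun j k => vecPoly r (S i k) j).det

theorem eval_basisPoly_ne_zero_iff (S : ∀ i, Fin (r i) → Path Q i) (x : Rep Q r) :
    x.eval (basisPoly S) ≠ 0 ↔ ∀ i, IsUnit (pathMatrix x (S i)) := by
  have h : x.eval (basisPoly S) = ∏ i, (pathMatrix x (S i)).det := by
    rw [Rep.eval, basisPoly, map_prod]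
    refine Finset.prod_congr rfl fun i _ => ?_
    rw [RingHom.map_det]
    congr 1
    ext j k
    exact eval_vecPoly x (S i k) j
  simp [h, Finset.prod_ne_zero_iff, isUnit_iff_isUnit_det]

theorem isUnit_pathMatrix_smul_iff (g : Gauge r) (x : Rep Q r) {i : Fin (ρ + 1)}
    (S : Fin (r i) → Path Q i) :
    IsUnit (pathMatrix (g • x) S) ↔ IsUnit (pathMatrix x S) := by
  have : pathMatrix (g • x) S = (g.full i).val * pathMatrix x S := by
    ext j k
    exact congrFun (vec_gauge_smul g x (S k)) j
  rw [this, Units.isUnit_units_mul]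

theorem isFixed_of_mk_mem_fixedPoints {x : semistable Q r}
    (hx : M.mk x ∈ MulAction.fixedPoints (Torus A) (M Q r)) : IsFixed x.1 := fun τ => by
  obtain ⟨g, hg⟩ := Quotient.exact (hx τ)
  exact ⟨g, (congrArg Subtype.val hg).symm⟩

theorem isOpen_classical_eval_ne_zero (p : MvPolynomial (Coord Q r) ℂ) :
    IsOpen[Rep.classical Q r] {x | x.eval p ≠ 0} := by
  let := Rep.classical Q r
  refine isOpen_ne_fun ((MvPolynomial.continuous_eval p).comp ?_) continuous_const
  refine continuous_pi fun c => ?_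
  exact (continuous_apply (A := fun a : A => Matrix (Fin (r (Q.t a))) (Fin (r (Q.s a))) ℂ)
    c.1).matrix_elem _ _

/-- The principal open set of `basisPoly S` descends to an open set of the quotient. -/
theorem isOpen_coinduced_isUnit_pathMatrix (𝒯 : TopologicalSpace (Rep Q r))
    (h𝒯 : ∀ p : MvPolynomial (Coord Q r) ℂ, IsOpen[𝒯] {x | x.eval p ≠ 0})
    (S : ∀ i, Fin (r i) → Path Q i) :
    IsOpen[TopologicalSpace.coinduced M.mk (TopologicalSpace.induced Subtype.val 𝒯)]
      (M.mk '' {x : semistable Q r | ∀ i, IsUnit (pathMatrix x.1 (S i))}) := by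
  refine isOpen_coinduced.mpr (isOpen_induced_iff.mpr ⟨_, h𝒯 (basisPoly S), ?_⟩)
  ext x
  rw [Set.mem_preimage, Set.mem_ofPred_eq, eval_basisPoly_ne_zero_iff]
  refine ⟨fun h => ⟨x, h, rfl⟩, ?_⟩
  rintro ⟨y, hy, hyx⟩ i
  obtain ⟨g, rfl⟩ := Quotient.exact hyx
  exact (isUnit_pathMatrix_smul_iff g x.1 _).mp (hy i)

end QuiverFlag

end

theorem mainTheorem8 {ρ : ℕ} {A : Type*} [Finite A] (Q : QuiverFlag.FlagQuiver ρ A)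
    (r : Fin (ρ + 1) → ℕ) (hr : r 0 = 1) :
    ∀ p ∈ MulAction.fixedPoints (QuiverFlag.Torus A) (QuiverFlag.M Q r),
      QuiverFlag.IsIsolatedIn (QuiverFlag.M.zariski Q r)
          (MulAction.fixedPoints (QuiverFlag.Torus A) (QuiverFlag.M Q r)) p ∧
      QuiverFlag.IsIsolatedIn (QuiverFlag.M.classical Q r)
          (MulAction.fixedPoints (QuiverFlag.Torus A) (QuiverFlag.M Q r)) p := by
  open QuiverFlag in
  intro p hp
  obtain ⟨x, rfl⟩ : ∃ x, M.mk x = p := Quotient.exists_rep p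
  have hxf := isFixed_of_mk_mem_fixedPoints hp
  obtain ⟨S, hS⟩ := exists_basis_paths hr x.2 hxf
  have hU : M.mk '' {x : semistable Q r | ∀ i, IsUnit (pathMatrix x.1 (S i))} ∩
      MulAction.fixedPoints (Torus A) (M Q r) = {M.mk x} := by
    refine Set.Subset.antisymm ?_ (Set.singleton_subset_iff.mpr ⟨⟨x, hS, rfl⟩, hp⟩)
    rintro _ ⟨⟨y, hyS, rfl⟩, hy⟩
    obtain ⟨g, hg⟩ := exists_smul_eq hr x.2 y.2 hxf (isFixed_of_mk_mem_fixedPoints hy) hS hyS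
    exact Quotient.sound ⟨g, Subtype.ext hg⟩
  exact ⟨⟨_, isOpen_coinduced_isUnit_pathMatrix (Rep.zariski Q r)
      (fun q => TopologicalSpace.isOpen_generateFrom_of_mem ⟨q, rfl⟩) S, hU⟩,
    ⟨_, isOpen_coinduced_isUnit_pathMatrix (Rep.classical Q r)
      isOpen_classical_eval_ne_zero S, hU⟩⟩
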